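/- For integers $k$ put $\frac1{k!}=0$ if $k<0$, and let $(a)_k=a(a+1)\cdots(a+k-1)$ for $k\ge 1$, $(a)_0=1$. Then for every positive integer $n$ and every nonnegative integer $m$, $$ \det_{1\le i,j\le 2n-1}\left(\frac{(2n+m-i-1)!}{(m+i-j)!\,(2n-2i+j)!}\cdot\begin{cases} n+m-\frac j2 & \text{if } i\ne n\\ j & \text{if } i=n\end{cases}\right) $$ $$ =\frac{1}{2^{3n-3}\,(n-1)!}\;\prod_{i=1}^{n}(2i-1)!^2\;\prod_{i=1}^{2n-1}\frac{(2n+m-i-1)!}{(m+i-1)!\,(4n-2i-1)!}\;\prod_{i=1}^{2n-2}(2m+i+1)_i\;\cdot\;\sum_{i=0}^{n-1}\frac{(-1)^{n-i-1}}{2n-2i-1}\,\frac{(m+n-i)_{2i}}{i!^2}. $$ -/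

import Mathlib

open scoped Nat

/-- The reciprocal factorial `1 / k!` of an integer `k`, equal to `0` for negative `k`. -/
def invFactorial (k : ℤ) : ℚ :=
  if 0 ≤ k then 1 / (k.toNat ! : ℚ) else 0

/-- The entry in row `i` and column `j`, where `1 ≤ i, j ≤ 2n - 1`. -/
def halfHexEntry (n m i j : ℕ) : ℚ :=
  ((2 * n + m - i - 1)! : ℚ)
    * invFactorial ((m : ℤ) + i - j) * invFactorial (2 * (n : ℤ) - 2 * i + j)
    * (if i = n then (j : ℚ) else (n : ℚ) + m - (j : ℚ) / 2)

/-- The matrix with rows and columns `1, …, 2n - 1`; the indices in `Fin` start at `0`. -/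
def halfHexMatrix (n m : ℕ) : Matrix (Fin (2 * n - 1)) (Fin (2 * n - 1)) ℚ :=
  Matrix.of fun a b => halfHexEntry n m ((a : ℕ) + 1) ((b : ℕ) + 1)

/-!
Put `n = r + 1`. Reversing rows and columns and multiplying by the unitriangular Pascal matrix turns
every row into a polynomial in `q = m + k`, by Vandermonde's convolution: with
`c l = (q + l) (q + l - 1) ⋯ (q - l + 1)`, row `l` becomes `(q + 1 / 2) * c l / (2 * l + 1)!`,
except that the middle row becomes `c r / (2 * r)!`. Since `c l` is the Newton basis polynomial of
degree `l` in `q (q + 1)` at the nodes `t (t + 1)`, the determinant is a Vandermonde determinant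
times the coefficient at `c r` in the Newton expansion of the polynomial in `q (q + 1)` that
interpolates `c r / (q + 1 / 2)`.

Up to a constant, `c r / (q + 1 / 2)` is `c r` times a product of two falling factorials in a new
variable `s`, evaluated at `s = r + 1 / 2`. Lagrange interpolation of that product in `s` at
`0, …, 2 * r` gives the interpolating polynomial: at an integer node `s = i`, it cancels against
`c r` and leaves a polynomial in `q (q + 1)` of degree at most `2 * r - i`. Only the terms with
`i ≤ r` reach degree `r`, and these are the terms of the sum.
-/

open Finset Lagrange Matrix Polynomial

section NewtonExpansion

variable {R : Type*} [CommRing R]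

/-- The coefficient of `∏ t < l, (X - v t)` in the Newton expansion of a polynomial at the nodes
`v 0, v 1, …`, which may repeat. Reducing modulo `∏ t ≤ l, (X - v t)` removes all later terms and
leaves this one in top degree. -/
noncomputable def newtonCoeff (v : ℕ → R) (l : ℕ) : R[X] →ₗ[R] R :=
  lcoeff R l ∘ₗ modByMonicHom (nodal (range (l + 1)) v)

theorem newtonCoeff_apply (v : ℕ → R) (l : ℕ) (f : R[X]) :
    newtonCoeff v l f = (f %ₘ nodal (range (l + 1)) v).coeff l :=
  rfl

theorem nodal_range_succ (v : ℕ → R) (l : ℕ) :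
    nodal (range (l + 1)) v = nodal (range l) v * (X - C (v l)) :=
  prod_range_succ _ _

theorem degree_nodal_range [Nontrivial R] (v : ℕ → R) (l : ℕ) : (nodal (range l) v).degree = l := by
  rw [degree_nodal, card_range]

theorem coeff_nodal_range_self (v : ℕ → R) (l : ℕ) : (nodal (range l) v).coeff l = 1 := by
  nontriviality R
  have hmonic : (nodal (range l) v).Monic := nodal_monic
  simpa only [natDegree_nodal, card_range] using hmonic.coeff_natDegree

theorem modByMonic_nodal_range (v : ℕ → R) (f : R[X]) (l : ℕ) :
    f %ₘ nodal (range l) v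
      = f %ₘ nodal (range (l + 1)) v - newtonCoeff v l f • nodal (range l) v := by
  nontriviality R
  have hmonic : (nodal (range l) v).Monic := nodal_monic
  set p := f %ₘ nodal (range (l + 1)) v
  have hdvd : nodal (range l) v ∣ f - (p - newtonCoeff v l f • nodal (range l) v) := by
    have hfp : nodal (range l) v ∣ f - p :=
      (nodal_range_succ v l ▸ dvd_mul_right _ _).trans
        ((dvd_sub_comm).mp (dvd_modByMonic_sub f (nodal (range (l + 1)) v)))
    rw [sub_sub_eq_add_sub, add_sub_right_comm]
    exact dvd_add hfp (smul_eq_C_mul (newtonCoeff v l f) ▸ dvd_mul_left _ _)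
  rw [modByMonic_eq_of_dvd_sub hmonic hdvd, modByMonic_eq_self_iff hmonic, degree_nodal_range,
    degree_lt_iff_coeff_zero]
  intro k hk
  rcases hk.eq_or_lt with rfl | hk
  · rw [coeff_sub, coeff_smul, coeff_nodal_range_self, newtonCoeff_apply, smul_eq_mul, mul_one,
      sub_self]
  · have hpdeg : p.degree < (l + 1 : ℕ) :=
      degree_nodal_range v (l + 1) ▸ degree_modByMonic_lt f nodal_monic
    rw [coeff_sub, coeff_smul, coeff_eq_zero_of_degree_lt (hpdeg.trans_le (by exact_mod_cast hk)),
      coeff_eq_zero_of_degree_lt (by rw [degree_nodal_range]; exact_mod_cast hk), smul_zero,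
      sub_zero]

theorem modByMonic_nodal_range_eq_sum (v : ℕ → R) (f : R[X]) (N : ℕ) :
    f %ₘ nodal (range N) v = ∑ l ∈ range N, newtonCoeff v l f • nodal (range l) v := by
  induction N with
  | zero => simp only [range_zero, nodal_empty, modByMonic_one, sum_empty]
  | succ N ih => rw [sum_range_succ, ← ih, modByMonic_nodal_range v f N, sub_add_cancel]

theorem eq_sum_newtonCoeff_smul (v : ℕ → R) {f : R[X]} {N : ℕ} (hf : f.degree < N) :
    f = ∑ l ∈ range N, newtonCoeff v l f • nodal (range l) v := by
  nontriviality R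
  rw [← modByMonic_nodal_range_eq_sum,
    (modByMonic_eq_self_iff nodal_monic).mpr (by rwa [degree_nodal_range])]

theorem newtonCoeff_eq_zero_of_degree_lt (v : ℕ → R) {l : ℕ} {f : R[X]} (hf : f.degree < l) :
    newtonCoeff v l f = 0 := by
  rw [newtonCoeff_apply]
  exact coeff_eq_zero_of_degree_lt (degree_modByMonic_le_left.trans_lt hf)

theorem newtonCoeff_nodal_mul (v : ℕ → R) (l : ℕ) (q : R[X]) :
    newtonCoeff v l (nodal (range l) v * q) = q.eval (v l) := by
  nontriviality R
  have hdvd : nodal (range (l + 1)) v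
      ∣ nodal (range l) v * q - q.eval (v l) • nodal (range l) v := by
    rw [smul_eq_C_mul, mul_comm (C _), ← mul_sub, nodal_range_succ]
    exact mul_dvd_mul_left _ X_sub_C_dvd_sub_C_eval
  have hdeg : (nodal (range l) v).degree < (nodal (range (l + 1)) v).degree := by
    rw [degree_nodal_range, degree_nodal_range]
    exact_mod_cast l.lt_succ_self
  rw [newtonCoeff_apply, modByMonic_eq_of_dvd_sub nodal_monic hdvd, smul_modByMonic,
    (modByMonic_eq_self_iff nodal_monic).mpr hdeg, coeff_smul, coeff_nodal_range_self, smul_eq_mul,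
    mul_one]

theorem det_eval_nodal_range {N : ℕ} (v : ℕ → R) (y : Fin N → R) :
    (of fun l k : Fin N => (nodal (range l) v).eval (y k)).det = (vandermonde y).det := by
  nontriviality R
  rw [← det_transpose, det_eval_matrixOfPolynomials_eq_det_vandermonde y
    (fun l => nodal (range l) v) (fun l => by rw [natDegree_nodal, card_range])
    fun l => nodal_monic]
  rfl

theorem det_updateRow_eval_nodal_range {N : ℕ} (v : ℕ → R) (y : Fin N → R) (i : Fin N) {f : R[X]}
    (hf : f.degree < N) :
    ((of fun l k : Fin N => (nodal (range l) v).eval (y k)).updateRow i fun k => f.eval (y k)).det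
      = newtonCoeff v i f * (vandermonde y).det := by
  have hrow : (fun k => f.eval (y k)) = ∑ l : Fin N,
      newtonCoeff v l f • (of fun l k : Fin N => (nodal (range l) v).eval (y k)) l := by
    ext k
    conv_lhs => rw [eq_sum_newtonCoeff_smul v hf]
    rw [Finset.sum_apply, eval_finsetSum, ← Fin.sum_univ_eq_sum_range
      (fun l => (newtonCoeff v l f • nodal (range l) v).eval (y k))]
    exact sum_congr rfl fun l _ => eval_smul ..
  rw [hrow, det_updateRow_sum _ i fun l => newtonCoeff v l f, det_eval_nodal_range, smul_eq_mul]

theorem mul_det_updateRow_eval_nodal_range {N : ℕ} (v : ℕ → R) (y w g : Fin N → R) (i : Fin N)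
    {f : R[X]} (hf : f.degree < N) {a : R} (hg : ∀ k, a * g k = w k * f.eval (y k)) :
    a * ((of fun l k : Fin N => w k * (nodal (range l) v).eval (y k)).updateRow i g).det
      = (∏ k, w k) * (newtonCoeff v i f * (vandermonde y).det) := by
  rw [← det_updateRow_smul, ← det_updateRow_eval_nodal_range v y i hf, ← det_mul_row]
  congr 1
  ext l k
  rw [updateRow_apply, of_apply, of_apply, updateRow_apply, of_apply]
  split_ifs
  · exact hg k
  · rfl

end NewtonExpansion

section Interpolation

theorem prod_erase_range_natCast_sub {R : Type*} [CommRing R] {N i : ℕ} (hi : i ≤ N) :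
    ∏ j ∈ (range (N + 1)).erase i, ((i : R) - j) = (-1) ^ (N - i) * i ! * (N - i)! := by
  induction N, hi using Nat.le_induction with
  | base =>
    rw [range_add_one, erase_insert notMem_range_self, ← descPochhammer_eval_eq_prod_range,
      descPochhammer_eval_eq_descFactorial, Nat.descFactorial_self, Nat.sub_self,
      Nat.factorial_zero, pow_zero, one_mul, Nat.cast_one, mul_one]
  | succ N hN ih =>
    rw [range_add_one, erase_insert_of_ne (by omega), prod_insert (by simp), ih,
      Nat.sub_add_comm hN, Nat.factorial_succ]
    push_cast [Nat.cast_sub hN]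
    ring

variable {K : Type*} [Field K] [CharZero K]

theorem nodalWeight_range_natCast {N i : ℕ} (hi : i ≤ N) :
    nodalWeight (range (N + 1)) (Nat.cast : ℕ → K) i = (-1) ^ (N - i) * N.choose i / N ! := by
  have h₁ : (i ! : K) ≠ 0 := Nat.cast_ne_zero.mpr i.factorial_ne_zero
  have h₂ : ((N - i)! : K) ≠ 0 := Nat.cast_ne_zero.mpr (N - i).factorial_ne_zero
  have h₃ : (N ! : K) ≠ 0 := Nat.cast_ne_zero.mpr N.factorial_ne_zero
  rw [nodalWeight, prod_inv_distrib, prod_erase_range_natCast_sub hi, Nat.cast_choose K hi]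
  rw [mul_inv, mul_inv, ← inv_pow, inv_neg_one]
  field_simp

theorem eval_eq_sum_choose {N : ℕ} {f : K[X]} (hf : f.natDegree ≤ N) {s : K}
    (hs : ∀ i ≤ N, s ≠ i) :
    f.eval s = (∏ i ∈ range (N + 1), (s - i)) / N ! *
      ∑ i ∈ range (N + 1), (-1) ^ (N - i) * N.choose i / (s - i) * f.eval (i : K) := by
  have hdeg : f.degree < #(range (N + 1)) := by
    rw [card_range]
    exact degree_le_natDegree.trans_lt (by exact_mod_cast Nat.lt_succ_of_le hf)
  conv_lhs => rw [eq_interpolate Nat.cast_injective.injOn hdeg,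
    eval_interpolate_not_at_node _ fun i hi => hs i (mem_range_succ_iff.mp hi), eval_nodal]
  rw [div_mul_eq_mul_div, mul_div_assoc, sum_div]
  congr 1
  refine sum_congr rfl fun i hi => ?_
  rw [nodalWeight_range_natCast (mem_range_succ_iff.mp hi)]
  ring

end Interpolation

section CentralFactorial

variable {R : Type*} [CommRing R]

theorem descPochhammer_eval_add (k l : ℕ) (a : R) :
    (descPochhammer R (k + l)).eval a
      = (descPochhammer R k).eval a * (descPochhammer R l).eval (a - k) := by
  rw [← descPochhammer_mul, eval_mul, eval_comp, eval_sub, eval_X, eval_natCast]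

theorem descPochhammer_eval_mul_eval_of_add_eq {a b : R} {p q p' q' : ℕ}
    (h : p + q = p' + q') (hab : a - p = b - q') :
    (descPochhammer R p).eval a * (descPochhammer R q).eval b
      = (descPochhammer R p').eval a * (descPochhammer R q').eval b := by
  wlog hp : p ≤ p' generalizing p q p' q'
  · refine (this h.symm ?_ (by omega)).symm
    have hcast : (p + q : R) = p' + q' := by
      simpa only [Nat.cast_add] using congrArg (Nat.cast : ℕ → R) h
    linear_combination hab + hcast
  obtain ⟨d, rfl⟩ := Nat.exists_eq_add_of_le hp
  obtain rfl : q = q' + d := by omega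
  rw [descPochhammer_eval_add, descPochhammer_eval_add, hab]
  ring

/-- The pronic value `x (x + 1)`: it is invariant under `x ↦ -1 - x`, and the central factorials are
polynomials in it. -/
def pronic (x : R) : R := x * (x + 1)

theorem pronic_sub_pronic (x y : R) : pronic x - pronic y = (x - y) * (x + y + 1) := by
  simp only [pronic]
  ring

/-- The central factorial `(x + l)(x + l - 1) ⋯ (x - l + 1)` as a monic polynomial of degree `l` in
`x (x + 1)`. -/
noncomputable def centralFactorial (R : Type*) [CommRing R] (l : ℕ) : R[X] :=
  nodal (range l) fun t => pronic (t : R)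

theorem eval_centralFactorial (l : ℕ) (x : R) :
    (centralFactorial R l).eval (pronic x) = (descPochhammer R (2 * l)).eval (x + l) := by
  rw [centralFactorial, eval_nodal]
  induction l with
  | zero => simp
  | succ l ih =>
    rw [prod_range_succ, ih, pronic_sub_pronic, show 2 * (l + 1) = 1 + 2 * l + 1 by ring,
      descPochhammer_succ_eval, descPochhammer_eval_add, descPochhammer_one, eval_X]
    push_cast
    ring_nf

theorem eval_centralFactorial_natCast (l q : ℕ) :
    (centralFactorial R l).eval (pronic (q : R)) = (2 * l)! * (q + l).choose (2 * l) := by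
  rw [eval_centralFactorial, ← Nat.cast_add, descPochhammer_eval_eq_descFactorial,
    Nat.descFactorial_eq_factorial_mul_choose, Nat.cast_mul]

theorem eval_centralFactorial_eq_ascPochhammer (l : ℕ) (x : R) :
    (centralFactorial R l).eval (pronic x) = (ascPochhammer R (2 * l)).eval (x + 1 - l) := by
  rw [eval_centralFactorial, descPochhammer_eval_eq_ascPochhammer]
  congr 1
  push_cast
  ring

theorem factorial_mul_eval_centralFactorial {r i : ℕ} (h : i ≤ r) :
    i ! * (centralFactorial R (r - i)).eval (pronic (r : R)) = (2 * r - i)! := by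
  have hchoose := Nat.choose_mul_factorial_mul_factorial
    (show 2 * (r - i) ≤ r + (r - i) by omega)
  rw [show r + (r - i) - 2 * (r - i) = i by omega, show r + (r - i) = 2 * r - i by omega] at hchoose
  rw [eval_centralFactorial_natCast, show r + (r - i) = 2 * r - i by omega, ← hchoose]
  push_cast
  ring

theorem ascPochhammer_eval_eq_prod_range (k : ℕ) (a : R) :
    (ascPochhammer R k).eval a = ∏ i ∈ range k, (a + i) := by
  induction k with
  | zero => rw [ascPochhammer_zero, eval_one, prod_range_zero]
  | succ k ih => rw [ascPochhammer_succ_eval, ih, prod_range_succ]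

theorem det_vandermonde_eq_prod_range (v : ℕ → R) (N : ℕ) :
    (vandermonde fun k : Fin N => v k).det = ∏ j ∈ range N, ∏ i ∈ range j, (v j - v i) := by
  have hswap : ∏ i : Fin N, ∏ j ∈ Ioi i, (v j - v i) = ∏ j : Fin N, ∏ i ∈ Iio j, (v j - v i) :=
    prod_comm' (by simp only [mem_univ, mem_Ioi, mem_Iio, true_and, and_true, implies_true])
  rw [det_vandermonde, hswap, ← Fin.prod_univ_eq_prod_range]
  refine prod_congr rfl fun j _ => ?_
  rw [← Nat.Iio_eq_range, ← Fin.map_valEmbedding_Iio, prod_map]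
  rfl

theorem det_vandermonde_pronic (x : R) (N : ℕ) :
    (vandermonde fun k : Fin N => pronic (x + (k : ℕ))).det
      = ∏ j ∈ range N, (j ! * (ascPochhammer R j).eval (2 * x + j + 1)) := by
  rw [det_vandermonde_eq_prod_range fun k => pronic (x + k)]
  refine prod_congr rfl fun j _ => ?_
  have hfactorial : (j ! : R) = ∏ i ∈ range j, ((j : R) - i) := by
    rw [← descPochhammer_eval_eq_prod_range, descPochhammer_eval_eq_descFactorial,
      Nat.descFactorial_self]
  rw [hfactorial, ascPochhammer_eval_eq_prod_range, ← prod_mul_distrib]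
  refine prod_congr rfl fun i _ => ?_
  rw [pronic_sub_pronic]
  ring

/-- The quotient `centralFactorial r * centralFactorial (r - i) / centralFactorial (i - r)` for
`i ≤ 2 * r`, with truncated differences: the last factor is `1` if `i ≤ r`, the middle one if
`r ≤ i`. -/
noncomputable def centralQuotient (R : Type*) [CommRing R] (r i : ℕ) : R[X] :=
  nodal (Ico (i - r) r) (fun t => pronic (t : R)) * centralFactorial R (r - i)

theorem centralFactorial_mul_nodal_Ico {k r : ℕ} (h : k ≤ r) :
    centralFactorial R k * nodal (Ico k r) (fun t => pronic (t : R)) = centralFactorial R r :=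
  prod_range_mul_prod_Ico _ h

theorem natDegree_centralQuotient_le (r i : ℕ) : (centralQuotient R r i).natDegree ≤ 2 * r - i := by
  nontriviality R
  refine natDegree_mul_le.trans ?_
  rw [centralFactorial, natDegree_nodal, natDegree_nodal, Nat.card_Ico, card_range]
  omega

theorem newtonCoeff_centralQuotient_of_le {r i : ℕ} (h : i ≤ r) :
    newtonCoeff (fun t => pronic (t : R)) r (centralQuotient R r i)
      = (centralFactorial R (r - i)).eval (pronic (r : R)) := by
  rw [centralQuotient, Nat.sub_eq_zero_of_le h, ← range_eq_Ico, newtonCoeff_nodal_mul]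

theorem newtonCoeff_centralQuotient_of_lt {r i : ℕ} (h : r < i) (hi : i ≤ 2 * r) :
    newtonCoeff (fun t => pronic (t : R)) r (centralQuotient R r i) = 0 := by
  refine newtonCoeff_eq_zero_of_degree_lt _ (degree_le_natDegree.trans_lt ?_)
  have := natDegree_centralQuotient_le (R := R) r i
  exact_mod_cast (show _ < r by omega)

/-- The falling factorial product of degree `2 * r` whose value at a natural number `s` is the
quotient of `centralFactorial (r - s)` at `x + k` times `centralFactorial s` at `x + r` by
`centralFactorial (s - r)` at `x + k`, for `k ≤ 2 * r`. -/
noncomputable def crossFactorial (x : R) (r k : ℕ) : R[X] :=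
  (descPochhammer R (2 * r - k)).comp (C (x + r) + X)
    * (descPochhammer R k).comp (C (x + r + k) - X)

theorem eval_crossFactorial (x : R) (r k : ℕ) (s : R) :
    (crossFactorial x r k).eval s = (descPochhammer R (2 * r - k)).eval (x + r + s)
      * (descPochhammer R k).eval (x + r + k - s) := by
  simp only [crossFactorial, eval_mul, eval_comp, eval_add, eval_sub, eval_C, eval_X]

theorem eval_centralFactorial_mul_eval_centralFactorial (x : R) {r k : ℕ} (hk : k ≤ 2 * r) (i : ℕ) :
    (centralFactorial R (r - i)).eval (pronic (x + k))
        * (centralFactorial R i).eval (pronic (x + r))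
      = (crossFactorial x r k).eval (i : R)
        * (centralFactorial R (i - r)).eval (pronic (x + k)) := by
  simp only [eval_centralFactorial, eval_crossFactorial]
  obtain ⟨k', hk'⟩ := Nat.exists_eq_add_of_le hk
  have hcast : (2 * r : R) = k + k' := by
    simpa only [Nat.cast_add, Nat.cast_mul, Nat.cast_ofNat] using
      congrArg (Nat.cast : ℕ → R) hk'
  rw [show 2 * r - k = k' by omega]
  rcases le_total i r with h | h
  · rw [Nat.sub_eq_zero_of_le h, mul_zero, descPochhammer_zero, eval_one, mul_one,
      Nat.cast_sub h, show x + k + (r - i) = x + r + k - i by ring, mul_comm (eval _ _)]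
    refine descPochhammer_eval_mul_eval_of_add_eq (by omega) ?_
    push_cast
    ring
  · rw [Nat.sub_eq_zero_of_le h, mul_zero, descPochhammer_zero, eval_one, one_mul,
      show 2 * i = k' + (2 * (i - r) + k) by omega, descPochhammer_eval_add,
      descPochhammer_eval_add]
    push_cast [Nat.cast_sub h]
    rw [show x + r + i - k' = x + k + (i - r) by linear_combination hcast,
      show x + k + ((i : R) - r) - 2 * (i - r) = x + r + k - i by ring]
    ring

theorem eval_centralQuotient_mul_eval_centralFactorial (x : R) {r k i : ℕ} (hk : k ≤ 2 * r)
    (hi : i ≤ 2 * r) :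
    (centralQuotient R r i).eval (pronic (x + k)) * (centralFactorial R i).eval (pronic (x + r))
      = (centralFactorial R r).eval (pronic (x + k)) * (crossFactorial x r k).eval (i : R) := by
  rw [centralQuotient, eval_mul, mul_assoc,
    eval_centralFactorial_mul_eval_centralFactorial x hk,
    ← centralFactorial_mul_nodal_Ico (show i - r ≤ r by omega), eval_mul]
  ring

theorem natDegree_descPochhammer_le (l : ℕ) : (descPochhammer R l).natDegree ≤ l :=
  descPochhammer_map (Int.castRingHom R) l ▸
    natDegree_map_le.trans (descPochhammer_natDegree ℤ l).le

theorem natDegree_crossFactorial_le (x : R) {r k : ℕ} (hk : k ≤ 2 * r) :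
    (crossFactorial x r k).natDegree ≤ 2 * r := by
  have hcomp (l : ℕ) {q : R[X]} (hq : q.natDegree ≤ 1) :
      ((descPochhammer R l).comp q).natDegree ≤ l :=
    natDegree_comp_le.trans <|
      (Nat.mul_le_mul (natDegree_descPochhammer_le l) hq).trans_eq (mul_one l)
  refine (natDegree_mul_le_of_le (hcomp (2 * r - k) ?_) (hcomp k ?_)).trans (by omega)
  · compute_degree
  · compute_degree

end CentralFactorial

section CentralInterpolant

variable {K : Type*} [Field K]

/-- The polynomial whose value at `pronic (x + k)` is `∏ j ≤ 2 * r, (x + j + 1 / 2)` times the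
quotient of `centralFactorial r` by `x + k + 1 / 2`, for `k ≤ 2 * r`. Its coefficients are those of
Lagrange interpolation of `crossFactorial x r k` at `0, …, 2 * r`, evaluated at `r + 1 / 2`. -/
noncomputable def centralInterpolant (x : K) (r : ℕ) : K[X] :=
  ∑ i ∈ range (2 * r + 1),
    ((∏ j ∈ range (2 * r + 1), (r + 1 / 2 - j : K)) / (2 * r)! *
      ((-1) ^ (2 * r - i) * (2 * r).choose i / (r + 1 / 2 - i) *
        (centralFactorial K i).eval (pronic (x + r)))) • centralQuotient K r i

theorem degree_centralInterpolant_lt (x : K) (r : ℕ) :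
    (centralInterpolant x r).degree < (2 * r + 1 : ℕ) := by
  refine degree_le_natDegree.trans_lt (Nat.cast_lt.mpr (Nat.lt_succ_of_le ?_))
  refine natDegree_sum_le_of_forall_le _ _ fun i _ => (natDegree_smul_le _ _).trans ?_
  exact (natDegree_centralQuotient_le r i).trans (Nat.sub_le _ _)

/-- The matrix with rows `(y + 1 / 2) * centralFactorial l`, as functions of `y = x, x + 1, …`: up
to row factors and except for its middle row, `halfHexMatrix` reduces to it, with `x = m`. -/
noncomputable def centralMatrix (x : K) (N : ℕ) : Matrix (Fin N) (Fin N) K :=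
  of fun l k => (x + (k : ℕ) + 1 / 2) * (centralFactorial K l).eval (pronic (x + (k : ℕ)))

variable [CharZero K]

-- With `a = x + 2 * r + 1 / 2` the two falling factorials are `a ⋯ (x + k + 3 / 2)` and
-- `(x + k - 1 / 2) ⋯ (x + 1 / 2)`, so that exactly the factor `x + k + 1 / 2` is missing.
theorem mul_eval_crossFactorial_half (x : K) {r k : ℕ} (hk : k ≤ 2 * r) :
    (x + k + 1 / 2) * (crossFactorial x r k).eval (r + 1 / 2 : K)
      = ∏ j ∈ range (2 * r + 1), (x + j + 1 / 2) := by
  have hdesc : ∏ j ∈ range (2 * r + 1), (x + j + 1 / 2)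
      = (descPochhammer K (2 * r - k + (1 + k))).eval (x + 2 * r + 1 / 2) := by
    rw [show 2 * r - k + (1 + k) = 2 * r + 1 by omega, descPochhammer_eval_eq_prod_range,
      ← prod_range_reflect]
    refine prod_congr rfl fun j hj => ?_
    rw [Nat.add_sub_cancel, Nat.cast_sub (mem_range_succ_iff.mp hj)]
    push_cast
    ring
  rw [hdesc, eval_crossFactorial, descPochhammer_eval_add, descPochhammer_eval_add,
    descPochhammer_one, eval_X, Nat.cast_sub hk]
  push_cast
  ring_nf

theorem half_add_natCast_ne (r i : ℕ) : (r + 1 / 2 : K) ≠ i := by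
  intro h
  have h₂ : (2 * r + 1 : K) = 2 * i := by linear_combination 2 * h
  have : 2 * r + 1 = 2 * i := by exact_mod_cast h₂
  omega

theorem mul_eval_centralInterpolant (x : K) {r k : ℕ} (hk : k ≤ 2 * r) :
    (x + k + 1 / 2) * (centralInterpolant x r).eval (pronic (x + k))
      = (∏ j ∈ range (2 * r + 1), (x + j + 1 / 2))
        * (centralFactorial K r).eval (pronic (x + k)) := by
  have heval : (centralInterpolant x r).eval (pronic (x + k))
      = (centralFactorial K r).eval (pronic (x + k))
        * (crossFactorial x r k).eval (r + 1 / 2 : K) := by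
    rw [eval_eq_sum_choose (natDegree_crossFactorial_le x hk) fun i _ => half_add_natCast_ne r i,
      centralInterpolant, eval_finsetSum, mul_sum, mul_sum]
    refine sum_congr rfl fun i hi => ?_
    rw [eval_smul, smul_eq_mul]
    linear_combination (∏ j ∈ range (2 * r + 1), (r + 1 / 2 - j : K)) / (2 * r)! *
      ((-1) ^ (2 * r - i) * (2 * r).choose i / (r + 1 / 2 - i)) *
      eval_centralQuotient_mul_eval_centralFactorial x hk (mem_range_succ_iff.mp hi)
  rw [heval, ← mul_eval_crossFactorial_half x hk]
  ring

theorem newtonCoeff_centralInterpolant (x : K) (r : ℕ) :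
    newtonCoeff (fun t => pronic (t : K)) r (centralInterpolant x r)
      = (∏ j ∈ range (2 * r + 1), (r + 1 / 2 - j : K)) *
        ∑ i ∈ range (r + 1), (-1) ^ i / (r + 1 / 2 - i) *
          ((centralFactorial K i).eval (pronic (x + r)) / (i ! : K) ^ 2) := by
  have hfactorial (i : ℕ) : (i ! : K) ≠ 0 := Nat.cast_ne_zero.mpr i.factorial_ne_zero
  rw [centralInterpolant, map_sum, show 2 * r + 1 = r + 1 + r by ring, sum_range_add,
    sum_eq_zero (s := range r), add_zero, mul_sum]
  · refine sum_congr rfl fun i hi => ?_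
    have hir : i ≤ r := mem_range_succ_iff.mp hi
    have hcentral := factorial_mul_eval_centralFactorial (R := K) hir
    have hsign : (-1 : K) ^ (2 * r - i) = (-1) ^ i := neg_one_pow_congr (by grind)
    rw [map_smul, newtonCoeff_centralQuotient_of_le hir, smul_eq_mul, hsign,
      Nat.cast_choose K (by omega : i ≤ 2 * r), ← hcentral]
    have hne : (centralFactorial K (r - i)).eval (pronic (r : K)) ≠ 0 :=
      right_ne_zero_of_mul (hcentral ▸ hfactorial _)
    field_simp [hfactorial]
  · intro i hi
    rw [map_smul, newtonCoeff_centralQuotient_of_lt (by omega) (by grind), smul_zero]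

theorem det_updateRow_centralMatrix (x : K) (r : ℕ)
    (hx : ∏ j ∈ range (2 * r + 1), (x + j + 1 / 2) ≠ 0) :
    ((centralMatrix x (2 * r + 1)).updateRow ⟨r, by omega⟩
        fun k => (centralFactorial K r).eval (pronic (x + (k : ℕ)))).det
      = (∏ j ∈ range (2 * r + 1), (r + 1 / 2 - j : K)) *
        (∏ j ∈ range (2 * r + 1), (j ! * (ascPochhammer K j).eval (2 * x + j + 1))) *
        ∑ i ∈ range (r + 1), (-1) ^ i / (r + 1 / 2 - i) *
          ((centralFactorial K i).eval (pronic (x + r)) / (i ! : K) ^ 2) := by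
  refine mul_left_cancel₀ hx ((mul_det_updateRow_eval_nodal_range _ _ _ _ _
    (degree_centralInterpolant_lt x r) fun k => ?_).trans ?_)
  · exact (mul_eval_centralInterpolant x (by omega)).symm
  · rw [Fin.prod_univ_eq_prod_range (fun k => x + k + 1 / 2), newtonCoeff_centralInterpolant,
      det_vandermonde_pronic]
    ring

end CentralInterpolant

section Entries

theorem invFactorial_natCast (k : ℕ) : invFactorial k = 1 / k ! := by
  rw [invFactorial, if_pos k.cast_nonneg, Int.toNat_natCast]

theorem invFactorial_of_neg {k : ℤ} (h : k < 0) : invFactorial k = 0 :=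
  if_neg h.not_ge

theorem mul_invFactorial (k : ℤ) : k * invFactorial k = invFactorial (k - 1) := by
  rcases lt_trichotomy k 0 with h | rfl | h
  · rw [invFactorial_of_neg h, invFactorial_of_neg (by omega), mul_zero]
  · rw [invFactorial_of_neg (k := 0 - 1) (by omega), Int.cast_zero, zero_mul]
  · obtain ⟨t, rfl⟩ : ∃ t : ℕ, k = (t + 1 : ℕ) := ⟨(k - 1).toNat, by omega⟩
    rw [show ((t + 1 : ℕ) : ℤ) - 1 = t by omega, invFactorial_natCast, invFactorial_natCast,
      Nat.factorial_succ]
    push_cast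
    field_simp

/-- The binomial coefficient with integer lower index, equal to `0` outside of `0 ≤ k ≤ a`. -/
def intChoose (a : ℕ) (k : ℤ) : ℚ :=
  a ! * (invFactorial k * invFactorial (a - k))

theorem intChoose_natCast (a k : ℕ) : intChoose a k = a.choose k := by
  rcases le_or_gt k a with h | h
  · rw [intChoose, ← Nat.cast_sub h, invFactorial_natCast, invFactorial_natCast,
      Nat.cast_choose ℚ h]
    field_simp
  · rw [intChoose, invFactorial_of_neg (by omega : (a : ℤ) - k < 0), Nat.choose_eq_zero_of_lt h,
      mul_zero, mul_zero, Nat.cast_zero]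

theorem intChoose_of_neg (a : ℕ) {k : ℤ} (h : k < 0) : intChoose a k = 0 := by
  rw [intChoose, invFactorial_of_neg h, zero_mul, mul_zero]

theorem intChoose_eq_mul_left (a : ℕ) (k : ℤ) :
    intChoose a k = a ! * ((a + 1 - k : ℤ) * (invFactorial k * invFactorial (a + 1 - k))) := by
  rw [mul_left_comm (_ : ℚ) (invFactorial k), mul_invFactorial, intChoose, add_sub_right_comm,
    add_sub_cancel_right]

theorem intChoose_sub_one_eq_mul (a : ℕ) (k : ℤ) :
    intChoose a (k - 1) = a ! * (k * (invFactorial k * invFactorial (a + 1 - k))) := by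
  rw [← mul_assoc (k : ℚ), mul_invFactorial, intChoose, sub_sub_eq_add_sub]

theorem sum_intChoose_mul_choose (a L : ℕ) {κ N : ℕ} (h : κ < N) :
    ∑ j ∈ range N, intChoose a (L - j) * κ.choose j = (a + κ).choose L := by
  have hextend : ∑ j ∈ range N, intChoose a (L - j) * κ.choose j
      = ∑ j ∈ range (L + 1), intChoose a (L - j) * κ.choose j := by
    calc
      _ = ∑ j ∈ range (N + (L + 1)), intChoose a (L - j) * κ.choose j := by
        refine sum_subset (range_subset_range.mpr (by omega)) fun j _ hj => ?_
        rw [Nat.choose_eq_zero_of_lt (by grind), Nat.cast_zero, mul_zero]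
      _ = _ := by
        refine (sum_subset (range_subset_range.mpr (by omega)) fun j _ hj => ?_).symm
        rw [intChoose_of_neg _ (by grind), zero_mul]
  rw [hextend, add_comm a, Nat.add_choose_eq, Nat.sum_antidiagonal_eq_sum_range_succ_mk,
    Nat.cast_sum]
  refine sum_congr rfl fun j hj => ?_
  rw [← Nat.cast_sub (mem_range_succ_iff.mp hj), intChoose_natCast, Nat.cast_mul, mul_comm]

theorem halfHexEntry_reflect_of_ne {r l j : ℕ} (m : ℕ) (hl : l ≤ 2 * r) (hj : j ≤ 2 * r)
    (h : l ≠ r) :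
    halfHexEntry (r + 1) m (2 * r + 1 - l) (2 * r + 1 - j)
      = intChoose (m + l) ((2 * l + 1 : ℕ) - j) + intChoose (m + l) ((2 * l : ℕ) - j) / 2 := by
  rw [show ((2 * l : ℕ) : ℤ) - j = (2 * l + 1 : ℕ) - j - 1 by omega, intChoose_eq_mul_left,
    intChoose_sub_one_eq_mul, halfHexEntry, if_neg (by omega),
    show 2 * (r + 1) + m - (2 * r + 1 - l) - 1 = m + l by omega,
    show (m : ℤ) + (2 * r + 1 - l : ℕ) - (2 * r + 1 - j : ℕ)
      = (m + l : ℕ) + 1 - ((2 * l + 1 : ℕ) - j) by omega,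
    show 2 * ((r + 1 : ℕ) : ℤ) - 2 * (2 * r + 1 - l : ℕ) + (2 * r + 1 - j : ℕ)
      = (2 * l + 1 : ℕ) - j by omega, Nat.cast_sub (by omega : j ≤ 2 * r + 1)]
  push_cast
  ring

theorem halfHexEntry_reflect_self {r j : ℕ} (m : ℕ) (hj : j ≤ 2 * r) :
    halfHexEntry (r + 1) m (2 * r + 1 - r) (2 * r + 1 - j)
      = intChoose (m + r) ((2 * r : ℕ) - j) := by
  rw [show ((2 * r : ℕ) : ℤ) - j = (2 * r + 1 : ℕ) - j - 1 by omega, intChoose_sub_one_eq_mul,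
    halfHexEntry, if_pos (by omega), show 2 * (r + 1) + m - (2 * r + 1 - r) - 1 = m + r by omega,
    show (m : ℤ) + (2 * r + 1 - r : ℕ) - (2 * r + 1 - j : ℕ)
      = (m + r : ℕ) + 1 - ((2 * r + 1 : ℕ) - j) by omega,
    show 2 * ((r + 1 : ℕ) : ℤ) - 2 * (2 * r + 1 - r : ℕ) + (2 * r + 1 - j : ℕ)
      = (2 * r + 1 : ℕ) - j by omega, Nat.cast_sub (by omega : j ≤ 2 * r + 1)]
  push_cast
  ring

theorem choose_add_half_choose (q l : ℕ) :
    ((q + l).choose (2 * l + 1) : ℚ) + (q + l).choose (2 * l) / 2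
      = (q + 1 / 2) * (centralFactorial ℚ l).eval (pronic (q : ℚ)) / (2 * l + 1)! := by
  have hsucc : ((2 * l + 1)! : ℚ) * (q + l).choose (2 * l + 1)
      = (2 * l)! * (q + l).choose (2 * l) * (q - l) := by
    have := descPochhammer_succ_eval (2 * l) ((q + l : ℕ) : ℚ)
    rw [descPochhammer_eval_eq_descFactorial, descPochhammer_eval_eq_descFactorial,
      Nat.descFactorial_eq_factorial_mul_choose, Nat.descFactorial_eq_factorial_mul_choose] at this
    push_cast at this
    linear_combination this
  rw [eval_centralFactorial_natCast, eq_div_iff (by positivity)]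
  rw [Nat.factorial_succ] at hsucc ⊢
  push_cast at hsucc ⊢
  linear_combination hsucc

theorem det_pascal (R : Type*) [CommRing R] (N : ℕ) :
    (of fun j k : Fin N => ((k : ℕ).choose j : R)).det = 1 := by
  rw [det_of_isUpperTriangular]
  · simp only [of_apply, Nat.choose_self, Nat.cast_one, prod_const_one]
  · intro j k h
    have hlt : (k : ℕ) < j := h
    rw [of_apply, Nat.choose_eq_zero_of_lt hlt, Nat.cast_zero]

theorem halfHexMatrix_reflect_mul_pascal (r m : ℕ) (e : Fin (2 * r + 1) ≃ Fin (2 * (r + 1) - 1))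
    (he : ∀ l, (e l : ℕ) = 2 * r - l) :
    (halfHexMatrix (r + 1) m).submatrix e e
        * (of fun j k : Fin (2 * r + 1) => ((k : ℕ).choose j : ℚ))
      = of fun l k : Fin (2 * r + 1) => (1 / (2 * (l : ℕ) + 1)! : ℚ) *
        (centralMatrix (m : ℚ) (2 * r + 1)).updateRow ⟨r, by omega⟩
          ((2 * r + 1 : ℚ) • fun k : Fin (2 * r + 1) =>
            (centralFactorial ℚ r).eval (pronic (m + (k : ℕ) : ℚ))) l k := by
  have he' (l) : (e l : ℕ) + 1 = 2 * r + 1 - l := by rw [he]; omega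
  ext l k
  simp only [mul_apply, submatrix_apply, halfHexMatrix, centralMatrix, of_apply, updateRow_apply,
    he']
  rw [Fin.sum_univ_eq_sum_range (fun j => halfHexEntry (r + 1) m (2 * r + 1 - l) (2 * r + 1 - j)
    * ((k : ℕ).choose j : ℚ))]
  have hq : ((m + k : ℕ) : ℚ) = m + (k : ℕ) := Nat.cast_add _ _
  split_ifs with h
  · have hlr : (l : ℕ) = r := congrArg Fin.val h
    rw [hlr, sum_congr rfl fun j hj => by
        rw [halfHexEntry_reflect_self m (mem_range_succ_iff.mp hj)],
      sum_intChoose_mul_choose _ _ k.isLt, add_right_comm, Pi.smul_apply, smul_eq_mul, ← hq,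
      eval_centralFactorial_natCast, Nat.factorial_succ]
    push_cast
    field_simp
  · rw [sum_congr rfl fun j hj => by
        rw [halfHexEntry_reflect_of_ne m (by omega) (mem_range_succ_iff.mp hj)
          fun h' => h (Fin.ext h'), add_mul, div_mul_eq_mul_div],
      sum_add_distrib, ← sum_div, sum_intChoose_mul_choose _ _ k.isLt,
      sum_intChoose_mul_choose _ _ k.isLt, add_right_comm, choose_add_half_choose, hq]
    ring

theorem det_halfHexMatrix_succ (r m : ℕ) :
    (halfHexMatrix (r + 1) m).det
      = (∏ l ∈ range (2 * r + 1), (1 / (2 * l + 1)! : ℚ)) * (2 * r + 1) *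
        ((∏ j ∈ range (2 * r + 1), (r + 1 / 2 - j : ℚ)) *
          (∏ j ∈ range (2 * r + 1), (j ! * (ascPochhammer ℚ j).eval (2 * (m : ℚ) + j + 1))) *
          ∑ i ∈ range (r + 1), (-1) ^ i / (r + 1 / 2 - i) *
            ((centralFactorial ℚ i).eval (pronic (m + r : ℚ)) / (i ! : ℚ) ^ 2)) := by
  let e : Fin (2 * r + 1) ≃ Fin (2 * (r + 1) - 1) := Fin.revPerm.trans (finCongr (by omega))
  have he (l : Fin (2 * r + 1)) : (e l : ℕ) = 2 * r - l := by
    rw [Equiv.trans_apply, Fin.revPerm_apply, finCongr_apply, Fin.val_cast, Fin.val_rev]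
    omega
  have hpascal : (halfHexMatrix (r + 1) m).det = ((halfHexMatrix (r + 1) m).submatrix e e
      * (of fun j k : Fin (2 * r + 1) => ((k : ℕ).choose j : ℚ))).det := by
    rw [det_mul, det_pascal, mul_one, det_submatrix_equiv_self]
  rw [hpascal, halfHexMatrix_reflect_mul_pascal r m e he, det_mul_column, det_updateRow_smul,
    Fin.prod_univ_eq_prod_range (fun l => (1 / (2 * l + 1)! : ℚ)), mul_assoc,
    det_updateRow_centralMatrix _ _ (prod_ne_zero_iff.mpr fun k _ => by positivity)]

end Entries

section Constants

theorem prod_Icc_one_eq_prod_range {M : Type*} [CommMonoid M] (f : ℕ → M) (N : ℕ) :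
    ∏ i ∈ Icc 1 N, f i = ∏ i ∈ range N, f (i + 1) := by
  induction N with
  | zero => rfl
  | succ N ih => rw [prod_Icc_succ_top (by omega), prod_range_succ, ih]

theorem prod_factorial_quotient (r m : ℕ) :
    ∏ i ∈ Icc 1 (2 * r + 1),
        ((2 * (r + 1) + m - i - 1)! : ℚ) / (((m + i - 1)! : ℚ) * ((4 * (r + 1) - 2 * i - 1)! : ℚ))
      = ∏ l ∈ range (2 * r + 1), (1 / (2 * l + 1)! : ℚ) := by
  have hterm : ∀ k ∈ range (2 * r + 1), ((2 * (r + 1) + m - (k + 1) - 1)! : ℚ)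
        / (((m + (k + 1) - 1)! : ℚ) * ((4 * (r + 1) - 2 * (k + 1) - 1)! : ℚ))
      = ((m + (2 * r + 1 - 1 - k))! : ℚ)
        / (((m + k)! : ℚ) * ((2 * (2 * r + 1 - 1 - k) + 1)! : ℚ)) := fun k hk => by
    congr 2 <;> grind
  have hne : ∏ k ∈ range (2 * r + 1), ((m + k)! : ℚ) ≠ 0 :=
    prod_ne_zero_iff.mpr fun k _ => Nat.cast_ne_zero.mpr (m + k).factorial_ne_zero
  rw [prod_Icc_one_eq_prod_range, prod_congr rfl hterm, prod_div_distrib, prod_mul_distrib,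
    prod_range_reflect fun k => ((m + k)! : ℚ), prod_range_reflect fun k => ((2 * k + 1)! : ℚ),
    div_mul_cancel_left₀ hne, ← prod_inv_distrib]
  exact prod_congr rfl fun l _ => (one_div _).symm

theorem prod_half_sub_succ (r : ℕ) :
    ∏ j ∈ range (2 * (r + 1) + 1), ((r + 1 : ℕ) + 1 / 2 - j : ℚ)
      = -((r + 3 / 2) * (r + 1 / 2)) * ∏ j ∈ range (2 * r + 1), (r + 1 / 2 - j : ℚ) := by
  have hshift : ∏ j ∈ range (2 * r + 1), ((r + 1 : ℕ) + 1 / 2 - (j + 1 : ℕ) : ℚ)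
      = ∏ j ∈ range (2 * r + 1), (r + 1 / 2 - j : ℚ) :=
    prod_congr rfl fun j _ => by push_cast; ring
  rw [show 2 * (r + 1) + 1 = 2 * r + 1 + 1 + 1 by ring, prod_range_succ', prod_range_succ, hshift]
  push_cast
  ring

theorem pow_mul_prod_half_sub_mul_prod_factorial (r : ℕ) :
    2 ^ (3 * r + 1) * r ! * ((2 * r + 1) * (∏ j ∈ range (2 * r + 1), (r + 1 / 2 - j : ℚ)) *
        ∏ j ∈ range (2 * r + 1), (j ! : ℚ))
      = (-1) ^ r * ∏ i ∈ Icc 1 (r + 1), ((2 * i - 1)! : ℚ) ^ 2 := by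
  induction r with
  | zero => norm_num
  | succ r ih =>
    rw [prod_half_sub_succ, prod_Icc_succ_top (by omega),
      show 2 * (r + 1) + 1 = 2 * r + 1 + 1 + 1 by ring, prod_range_succ _ (2 * r + 1 + 1),
      prod_range_succ _ (2 * r + 1), show 2 * (r + 1 + 1) - 1 = 2 * r + 1 + 1 + 1 by omega,
      Nat.factorial_succ (2 * r + 1 + 1), Nat.factorial_succ (2 * r + 1), Nat.factorial_succ r]
    push_cast
    linear_combination -((2 * r + 3) * (2 * r + 2) * ((2 * r + 1)! : ℚ)) ^ 2 * ih

theorem prod_half_sub_mul_prod_factorial (r : ℕ) :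
    2 * (-1) ^ r * ((2 * r + 1) * (∏ j ∈ range (2 * r + 1), (r + 1 / 2 - j : ℚ)) *
        ∏ j ∈ range (2 * r + 1), (j ! : ℚ))
      = 1 / (2 ^ (3 * r) * r !) * ∏ i ∈ Icc 1 (r + 1), ((2 * i - 1)! : ℚ) ^ 2 := by
  have hsign : (-1 : ℚ) ^ r * (-1) ^ r = 1 := pow_mul_pow_eq_one r (by norm_num)
  rw [one_div_mul_eq_div, eq_div_iff (by positivity)]
  linear_combination (-1) ^ r * pow_mul_prod_half_sub_mul_prod_factorial r
    + (∏ i ∈ Icc 1 (r + 1), ((2 * i - 1)! : ℚ) ^ 2) * hsign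

theorem prod_Icc_ascPochhammer_eval {R : Type*} [CommSemiring R] (a : ℕ → R) (N : ℕ) :
    ∏ i ∈ Icc 1 N, (ascPochhammer R i).eval (a i)
      = ∏ i ∈ range (N + 1), (ascPochhammer R i).eval (a i) := by
  rw [prod_Icc_one_eq_prod_range, prod_range_succ', ascPochhammer_zero, eval_one, mul_one]

theorem sum_centralFactorial_eq_sum_ascPochhammer (r : ℕ) (x : ℚ) :
    ∑ i ∈ range (r + 1), (-1) ^ i / (r + 1 / 2 - i) *
        ((centralFactorial ℚ i).eval (pronic (x + r)) / (i ! : ℚ) ^ 2)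
      = 2 * (-1) ^ r * ∑ i ∈ range (r + 1),
          (-1) ^ (r + 1 - i - 1) / (2 * (r + 1 : ℕ) - 2 * i - 1) *
            ((ascPochhammer ℚ (2 * i)).eval (x + (r + 1 : ℕ) - i) / (i ! : ℚ) ^ 2) := by
  rw [mul_sum]
  refine sum_congr rfl fun i hi => ?_
  have hsign : (-1 : ℚ) ^ i = (-1) ^ r * (-1) ^ (r + 1 - i - 1) := by
    rw [← pow_add]
    exact neg_one_pow_congr (by grind)
  rw [eval_centralFactorial_eq_ascPochhammer, hsign, add_assoc, ← Nat.cast_succ,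
    show (r + 1 / 2 - i : ℚ) = (2 * (r + 1 : ℕ) - 2 * i - 1) / 2 by push_cast; ring,
    div_div_eq_mul_div]
  ring

end Constants

theorem lemma16 (n m : ℕ) (hn : 1 ≤ n) :
    (halfHexMatrix n m).det =
      1 / ((2 : ℚ) ^ (3 * n - 3) * ((n - 1)! : ℚ))
        * (∏ i ∈ Finset.Icc 1 n, ((2 * i - 1)! : ℚ) ^ 2)
        * (∏ i ∈ Finset.Icc 1 (2 * n - 1),
            ((2 * n + m - i - 1)! : ℚ) / (((m + i - 1)! : ℚ) * ((4 * n - 2 * i - 1)! : ℚ)))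
        * (∏ i ∈ Finset.Icc 1 (2 * n - 2), (ascPochhammer ℚ i).eval (2 * (m : ℚ) + i + 1))
        * ∑ i ∈ Finset.range n,
            (-1 : ℚ) ^ (n - i - 1) / (2 * (n : ℚ) - 2 * i - 1)
              * ((ascPochhammer ℚ (2 * i)).eval ((m : ℚ) + n - i) / (i ! : ℚ) ^ 2) := by
  obtain ⟨r, rfl⟩ := Nat.exists_eq_add_of_le' hn
  rw [det_halfHexMatrix_succ, sum_centralFactorial_eq_sum_ascPochhammer,
    show 2 * (r + 1) - 1 = 2 * r + 1 by omega, show 2 * (r + 1) - 2 = 2 * r by omega,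
    show 3 * (r + 1) - 3 = 3 * r by omega, Nat.add_sub_cancel, prod_factorial_quotient,
    prod_Icc_ascPochhammer_eval, prod_mul_distrib, ← prod_half_sub_mul_prod_factorial]
  ring
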